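/- Let $n\ge 3$, let $k$ be an algebraically closed field, let $\mathcal C$ be an additive $k$-linear category with split idempotents, and let $\Sigma:\mathcal C\to\mathcal C$ be a $k$-linear automorphism. Let $\operatorname{mod}\mathcal C$ be the category of finitely presented contravariant functors from $\mathcal C$ to $k$-modules, and extend $\Sigma$ to it by $\Sigma M=M\circ\Sigma^{-1}$. The category $\mathcal C$ is identified, by the Yoneda embedding, with the full subcategory $\operatorname{proj}\mathcal C$ of projective objects of $\operatorname{mod}\mathcal C$. Assume that $\operatorname{mod}\mathcal C$ is an abelian Frobenius category (enough projectives, enough injectives, and projectives coincide with injectives) and that there is an exact sequence of exact endofunctors of $\operatorname{mod}\mathcal C$ $$0\to \mathrm{Id}\xrightarrow{\iota} X^1\to X^2\to\cdots\to X^n\xrightarrow{\pi}\Sigma\to 0\qquad(\ast)$$ in which all $X^i$ take values in $\operatorname{proj}\mathcal C$. An *$n$-$\Sigma$-sequence* is a sequence $X_1\xrightarrow{f_1}X_2\to\cdots\to X_n\xrightarrow{f_n}\Sigma X_1$. An *$n$-$\Sigma$-complex* in $\mathcal C$ is an $n$-$\Sigma$-sequence in $\mathcal C$ that is exact, i.e.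 for which $\cdots\to\mathcal C(-,X_1)\to\cdots\to\mathcal C(-,X_n)\to\mathcal C(-,\Sigma X_1)\to\cdots$ is exact; it is continued $\Sigma$-periodically to an acyclic complex. Morphisms and homotopies of $n$-$\Sigma$-sequences are the $\Sigma$-periodic ones. For $M\in\operatorname{mod}\mathcal C$ the *standard $n$-angle* $T_M$ is $$X^1M\to X^2M\to\cdots\to X^nM\xrightarrow{\ \Sigma(\iota_M)\,\pi_M\ }\Sigma X^1M .$$ Fix for each $M\in\operatorname{mod}\mathcal C$ a short exact sequence $0\to M\to I_M\to\Omega^{-1}M\to0$ with $I_M\in\operatorname{proj}\mathcal C$; splicing gives exact sequences $0\to M\to I_M\to I_{\Omega^{-1}M}\to\cdots\to I_{\Omega^{1-n}M}\to\Omega^{-n}M\to 0$. Let $\alpha_M:\Sigma M\to\Omega^{-n}M$ be the morphism of the stable category $\underline{\operatorname{mod}}\,\mathcal C$ (morphisms modulo those factoring through projectives) induced by a map over $\mathrm{id}_M$ from the value of $(\ast)$ at $M$ to this sequence. If $X_\bullet$ is an $n$-$\Sigma$-complex and $M=\ker f_1\xrightarrow{\,l\,}X_1$ is the kernel in $\operatorname{mod}\mathcal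 C$, then $f_n$ factors as $X_n\twoheadrightarrow\Sigma M\xrightarrow{\Sigma l}\Sigma X_1$; let $\beta_M:\Sigma M\to\Omega^{-n}M$ be the morphism of $\underline{\operatorname{mod}}\,\mathcal C$ induced in the same way by the exact sequence $0\to M\to X_1\to\cdots\to X_n\to\Sigma M\to0$. Call $X_\bullet$ a *$\Phi$-$n$-$\Sigma$-complex* if $\beta_{\ker f_1}=\alpha_{\ker f_1}$ in $\underline{\operatorname{mod}}\,\mathcal C$. **Proposition 2.5.** An $n$-$\Sigma$-complex $X_\bullet$ in $\mathcal C$ is a $\Phi$-$n$-$\Sigma$-complex if and only if there is an $M\in\operatorname{mod}\mathcal C$ such that $X_\bullet$ is homotopy equivalent to $T_M$ via $n$-$\Sigma$-periodic morphisms and homotopies. In particular, the category of $\Phi$-$n$-$\Sigma$-complexes is equivalent (compatibly with the inclusions into the category of $n$-$\Sigma$-complexes) to the category of $n$-$\Sigma$-complexes that are homotopy equivalent to standard $n$-angles. -/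

import Mathlib

open CategoryTheory CategoryTheory.Limits Opposite

universe w v u v₁ u₁ v₂ u₂

namespace NAngle

/-! ### `n`-`Σ`-sequences

Throughout, `n = r + 2` for a natural number `r`, and the terms `X₁, …, Xₙ` of a sequence are
numbered `0, …, r + 1`. -/

section Sequences

variable {D : Type u₁} [Category.{v₁} D]

/-- An `(r + 2)`-`S`-sequence `X 0 ⟶ X 1 ⟶ ⋯ ⟶ X (r + 1) ⟶ S (X 0)` in the category `D` with
endofunctor `S`: the arrows are `d 0, …, d r` and `last`. -/
structure NSeq (S : D ⥤ D) (r : ℕ) where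
  X : Fin (r + 2) → D
  d : ∀ (i : ℕ) (h : i < r + 1), X ⟨i, Nat.lt_succ_of_lt h⟩ ⟶ X ⟨i + 1, Nat.succ_lt_succ h⟩
  last : X ⟨r + 1, Nat.lt_succ_self _⟩ ⟶ S.obj (X ⟨0, Nat.succ_pos _⟩)

variable {S : D ⥤ D} {r : ℕ}

/-- The (`S`-periodic) morphisms of `(r + 2)`-`S`-sequences. -/
@[ext]
structure NSeq.Hom (X Y : NSeq S r) where
  φ : ∀ i, X.X i ⟶ Y.X i
  comm : ∀ (i : ℕ) (h : i < r + 1),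
    X.d i h ≫ φ ⟨i + 1, Nat.succ_lt_succ h⟩ = φ ⟨i, Nat.lt_succ_of_lt h⟩ ≫ Y.d i h
  comm_last : X.last ≫ S.map (φ ⟨0, Nat.succ_pos _⟩) = φ ⟨r + 1, Nat.lt_succ_self _⟩ ≫ Y.last

instance : Category (NSeq S r) where
  Hom X Y := NSeq.Hom X Y
  id X :=
    { φ := fun _ => 𝟙 _
      comm := by intro i h; simp
      comm_last := by rw [S.map_id, Category.comp_id, Category.id_comp] }
  comp f g :=
    { φ := fun i => f.φ i ≫ g.φ i
      comm := by
        intro i h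
        rw [← Category.assoc, f.comm, Category.assoc, g.comm, Category.assoc]
      comm_last := by
        rw [S.map_comp, ← Category.assoc, f.comm_last, Category.assoc, g.comm_last,
          Category.assoc] }
  id_comp f := NSeq.Hom.ext (funext fun _ => Category.id_comp _)
  comp_id f := NSeq.Hom.ext (funext fun _ => Category.comp_id _)
  assoc f g h := NSeq.Hom.ext (funext fun _ => Category.assoc _ _ _)

/-- The image of a sequence under a functor `F` that commutes with the given endofunctors. -/
def NSeq.map {D' : Type u₂} [Category.{v₂} D'] {S' : D' ⥤ D'} (F : D ⥤ D') (e : S ⋙ F ≅ F ⋙ S')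
    (X : NSeq S r) : NSeq S' r where
  X i := F.obj (X.X i)
  d i h := F.map (X.d i h)
  last := F.map X.last ≫ e.hom.app _

variable [Preadditive D]

/-- Two morphisms `φ, ψ : X ⟶ Y` are homotopic through an `n`-`S`-periodic homotopy. The homotopy
consists of `h i : X (i + 1) ⟶ Y i` for `0 ≤ i ≤ r` and of `s : S (X 0) ⟶ Y (r + 1)`.
For an autoequivalence `S`, the map `s` amounts to a map `X 0 ⟶ S⁻¹ (Y (r + 1))`, and the last
equation is the homotopy equation in degree `0`, translated by `S`. -/
def Homotopic {X Y : NSeq S r} (φ ψ : X ⟶ Y) : Prop :=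
  ∃ (h : ∀ (i : ℕ) (hi : i < r + 1),
        X.X ⟨i + 1, Nat.succ_lt_succ hi⟩ ⟶ Y.X ⟨i, Nat.lt_succ_of_lt hi⟩)
    (s : S.obj (X.X ⟨0, Nat.succ_pos _⟩) ⟶ Y.X ⟨r + 1, Nat.lt_succ_self _⟩),
    (∀ (i : ℕ) (hi : i < r),
      NSeq.Hom.φ φ ⟨i + 1, Nat.lt_succ_of_lt (Nat.succ_lt_succ hi)⟩ -
          NSeq.Hom.φ ψ ⟨i + 1, Nat.lt_succ_of_lt (Nat.succ_lt_succ hi)⟩ =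
        X.d (i + 1) (Nat.succ_lt_succ hi) ≫ h (i + 1) (Nat.succ_lt_succ hi) +
          h i (Nat.lt_succ_of_lt hi) ≫ Y.d i (Nat.lt_succ_of_lt hi)) ∧
    (NSeq.Hom.φ φ ⟨r + 1, Nat.lt_succ_self _⟩ - NSeq.Hom.φ ψ ⟨r + 1, Nat.lt_succ_self _⟩ =
        X.last ≫ s + h r (Nat.lt_succ_self _) ≫ Y.d r (Nat.lt_succ_self _)) ∧
    (S.map (NSeq.Hom.φ φ ⟨0, Nat.succ_pos _⟩ - NSeq.Hom.φ ψ ⟨0, Nat.succ_pos _⟩) =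
        S.map (X.d 0 (Nat.succ_pos _) ≫ h 0 (Nat.succ_pos _)) + s ≫ Y.last)

/-- Homotopy equivalence via `n`-`S`-periodic morphisms and homotopies. -/
def HomotopyEquivalent (X Y : NSeq S r) : Prop :=
  ∃ (φ : X ⟶ Y) (ψ : Y ⟶ X), Homotopic (φ ≫ ψ) (𝟙 X) ∧ Homotopic (ψ ≫ φ) (𝟙 Y)

/-- Exactness of `D(-, X) ⟶ D(-, Y) ⟶ D(-, Z)` at `D(-, Y)`. -/
def HomExact {X Y Z : D} (f : X ⟶ Y) (g : Y ⟶ Z) : Prop :=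
  ∀ W : D, Function.Exact (fun a : W ⟶ X => a ≫ f) (fun b : W ⟶ Y => b ≫ g)

/-- Exactness of an `n`-`S`-sequence. For an autoequivalence `S`, exactness of
`⋯ ⟶ D(-, X₁) ⟶ ⋯ ⟶ D(-, Xₙ) ⟶ D(-, S X₁) ⟶ D(-, S X₂) ⟶ ⋯` has to be required at
`X₂, …, Xₙ, S X₁` only, the other places being translates of these. -/
def NSeq.exact : ObjectProperty (NSeq S r) := fun X =>
  (∀ (i : ℕ) (h : i < r), HomExact (X.d i (Nat.lt_succ_of_lt h)) (X.d (i + 1) (Nat.succ_lt_succ h))) ∧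
    HomExact (X.d r (Nat.lt_succ_self _)) X.last ∧
    HomExact X.last (S.map (X.d 0 (Nat.succ_pos _)))

end Sequences

/-- The category of (acyclic) `n`-`Σ`-complexes with `n`-`Σ`-periodic morphisms: such a complex is
the same as an exact `n`-`Σ`-sequence, continued periodically. -/
abbrev NComplex {D : Type u₁} [Category.{v₁} D] [Preadditive D] (S : D ⥤ D) (r : ℕ) :=
  (NSeq.exact (S := S) (r := r)).FullSubcategory

/-! ### Frobenius categories and stable categories -/

section Frobenius

variable (A : Type u₁) [Category.{v₁} A] [Preadditive A]

/-- `A` is an abelian category which, with all short exact sequences, is a Frobenius category. -/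
structure IsFrobenius : Prop where
  hasFiniteProducts : HasFiniteProducts A
  hasKernels : HasKernels A
  hasCokernels : HasCokernels A
  normalMono : IsNormalMonoCategory A
  normalEpi : IsNormalEpiCategory A
  enoughProjectives : EnoughProjectives A
  enoughInjectives : EnoughInjectives A
  projective_iff_injective : ∀ P : A, Projective P ↔ Injective P

/-- The relation of differing by a morphism that factors through a projective object. -/
def stableRel : HomRel A := fun M N f g =>
  ∃ (P : A) (_ : Projective P) (a : M ⟶ P) (b : P ⟶ N), f - g = a ≫ b

/-- The stable category of `A`. -/
abbrev Stable := CategoryTheory.Quotient (stableRel A)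

/-- The projection from `A` to its stable category. -/
abbrev toStable : A ⥤ Stable A := CategoryTheory.Quotient.functor (stableRel A)

end Frobenius

/-! ### The category `mod C` -/

section Modules

variable (k : Type w) [Field k] (C : Type u) [Category.{v} C] [Preadditive C] [Linear k C]

/-- Finitely presented contravariant functors `F` from `C` to `k`-modules: there is an exact
sequence `C(-, X) ⟶ C(-, Y) ⟶ F ⟶ 0`. -/
def finPres : ObjectProperty (Cᵒᵖ ⥤ ModuleCat.{v} k) := fun F =>
  ∃ (X Y : C) (f : X ⟶ Y) (p : (linearYoneda k C).obj Y ⟶ F),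
    ∀ W : Cᵒᵖ, Function.Exact (((linearYoneda k C).map f).app W).hom (p.app W).hom ∧
      Function.Surjective (p.app W).hom

/-- The category `mod C`. -/
abbrev Mod := (finPres k C).FullSubcategory

variable {k C}

lemma finPres_yoneda (X : C) : finPres k C ((linearYoneda k C).obj X) := by
  refine ⟨X, X, 0, 𝟙 _, fun W => ⟨fun y => ⟨fun hy => ⟨0, ?_⟩, ?_⟩, fun y => ⟨y, rfl⟩⟩⟩
  · rw [map_zero]
    exact hy.symm
  · rintro ⟨x, rfl⟩
    exact comp_zero (f := (show unop W ⟶ X from x))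

variable (k C) in
/-- The Yoneda embedding `C ⥤ mod C`. -/
def yon : C ⥤ Mod k C :=
  (finPres k C).lift (linearYoneda k C) finPres_yoneda

section

variable {B : Type u} [Category.{v} B] (S : B ≌ B)

lemma shift_aux₁ {X W W' : B} (f : W' ⟶ W) (g : W ⟶ S.functor.obj X) :
    S.inverse.map (f ≫ g) ≫ S.unitIso.inv.app X =
      S.inverse.map f ≫ S.inverse.map g ≫ S.unitIso.inv.app X := by
  simp

lemma shift_aux₂ {X Y W : B} (g : W ⟶ S.functor.obj X) (f : X ⟶ Y) :
    S.inverse.map (g ≫ S.functor.map f) ≫ S.unitIso.inv.app Y =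
      (S.inverse.map g ≫ S.unitIso.inv.app X) ≫ f := by
  simp

lemma shift_aux₃ {X Y W : B} (f : X ⟶ Y) (x : S.inverse.obj W ⟶ X) (y : W ⟶ S.functor.obj Y)
    (h : x ≫ f = S.inverse.map y ≫ S.unitIso.inv.app Y) :
    (S.counitIso.inv.app W ≫ S.functor.map x) ≫ S.functor.map f = y := by
  rw [Category.assoc, ← S.functor.map_comp, h]
  simp

lemma shift_aux₄ {Y W : B} (y : S.inverse.obj W ⟶ Y) :
    S.inverse.map (S.counitIso.inv.app W ≫ S.functor.map y) ≫ S.unitIso.inv.app Y = y := by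
  simp

end

variable (S : C ≌ C) [S.functor.Additive] [S.functor.Linear k]

/-- The natural isomorphism `C(-, Σ X) ≅ C(Σ⁻¹ -, X)`, given by `f ↦ Σ⁻¹ f`. -/
def yonedaShift : S.functor ⋙ linearYoneda k C ≅
    linearYoneda k C ⋙ (Functor.whiskeringLeft _ _ (ModuleCat.{v} k)).obj S.inverse.op :=
  NatIso.ofComponents
    (fun X => NatIso.ofComponents
      (fun W => LinearEquiv.toModuleIso
        (show (unop W ⟶ S.functor.obj X) ≃ₗ[k] (S.inverse.obj (unop W) ⟶ X) from
          { toFun := fun f => S.inverse.map f ≫ S.unitIso.inv.app X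
            invFun := fun g => S.counitIso.inv.app (unop W) ≫ S.functor.map g
            map_add' := fun f g => by simp [Functor.map_add]
            map_smul' := fun a f => by simp [Functor.map_smul]
            left_inv := fun f => by simp
            right_inv := fun g => by simp }))
      (fun {W W'} f => by
        ext g
        exact shift_aux₁ S f.unop g))
    (fun {X Y} f => by
      ext W g
      exact shift_aux₂ S g f)

lemma finPres_shift {F : Cᵒᵖ ⥤ ModuleCat.{v} k} (hF : finPres k C F) :
    finPres k C (S.inverse.op ⋙ F) := by
  obtain ⟨X, Y, f, p, hp⟩ := hF
  refine ⟨S.functor.obj X, S.functor.obj Y, S.functor.map f,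
    (yonedaShift S).hom.app Y ≫ Functor.whiskerLeft S.inverse.op p, fun W => ⟨?_, ?_⟩⟩
  · intro y
    have h := (hp (op (S.inverse.obj (unop W)))).1 (((yonedaShift S).hom.app Y).app W y)
    refine h.trans ⟨?_, ?_⟩
    · rintro ⟨x, hx⟩
      refine ⟨((yonedaShift S).inv.app X).app W x, ?_⟩
      exact shift_aux₃ S f x y hx
    · rintro ⟨x, rfl⟩
      refine ⟨((yonedaShift S).hom.app X).app W x, ?_⟩
      exact (shift_aux₂ S x f).symm
  · intro z
    obtain ⟨y, hy⟩ := (hp (op (S.inverse.obj (unop W)))).2 z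
    refine ⟨((yonedaShift S).inv.app Y).app W y, ?_⟩
    exact (congrArg (p.app (op (S.inverse.obj (unop W)))).hom (shift_aux₄ S y)).trans hy

/-- The extension of `Σ` to `mod C`, namely `M ↦ M ∘ Σ⁻¹`. -/
def shift : Mod k C ⥤ Mod k C :=
  (finPres k C).lift
    ((finPres k C).ι ⋙ (Functor.whiskeringLeft _ _ (ModuleCat.{v} k)).obj S.inverse.op)
    (fun M => finPres_shift S M.property)

/-- The Yoneda embedding commutes with `Σ`. -/
def yonShift : S.functor ⋙ yon k C ≅ yon k C ⋙ shift S :=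
  NatIso.ofComponents (fun X => (finPres k C).isoMk ((yonedaShift S).app X)) (fun {X Y} f => by
    apply ObjectProperty.hom_ext
    exact (yonedaShift S).hom.naturality f)

/-! Exactness in `mod C` is exactness at every object of `C`. -/

/-- `f` is injective at every object of `C`. -/
def Inj {M N : Mod k C} (f : M ⟶ N) : Prop := ∀ W, Function.Injective (f.hom.app W).hom

/-- `f` is surjective at every object of `C`. -/
def Surj {M N : Mod k C} (f : M ⟶ N) : Prop := ∀ W, Function.Surjective (f.hom.app W).hom

/-- `L ⟶ M ⟶ N` is exact at `M`. -/
def Exact {L M N : Mod k C} (f : L ⟶ M) (g : M ⟶ N) : Prop :=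
  ∀ W, Function.Exact (f.hom.app W).hom (g.hom.app W).hom

/-! ### Sequences `0 ⟶ M ⟶ Y₁ ⟶ ⋯ ⟶ Yₙ ⟶ N ⟶ 0` and comparison morphisms -/

/-- The data of a sequence `M ⟶ Y 0 ⟶ ⋯ ⟶ Y (r + 1) ⟶ N` in `mod C`. -/
structure LongSeq (r : ℕ) (M N : Mod k C) where
  Y : Fin (r + 2) → Mod k C
  ι : M ⟶ Y ⟨0, Nat.succ_pos _⟩
  d : ∀ (i : ℕ) (h : i < r + 1), Y ⟨i, Nat.lt_succ_of_lt h⟩ ⟶ Y ⟨i + 1, Nat.succ_lt_succ h⟩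
  π : Y ⟨r + 1, Nat.lt_succ_self _⟩ ⟶ N

/-- `0 ⟶ M ⟶ Y 0 ⟶ ⋯ ⟶ Y (r + 1) ⟶ N ⟶ 0` is exact. -/
structure LongSeq.IsExact {r : ℕ} {M N : Mod k C} (E : LongSeq r M N) : Prop where
  inj : Inj E.ι
  exact_ι : Exact E.ι (E.d 0 (Nat.succ_pos _))
  exact_d : ∀ (i : ℕ) (h : i < r),
    Exact (E.d i (Nat.lt_succ_of_lt h)) (E.d (i + 1) (Nat.succ_lt_succ h))
  exact_π : Exact (E.d r (Nat.lt_succ_self _)) E.π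
  surj : Surj E.π

/-- `α : N ⟶ N'` is induced by a morphism of sequences `E ⟶ E'` that is the identity on `M`. If
`E` is exact and `E'` is exact with injective middle terms, then such an `α` exists by the comparison
theorem, and all of them have the same class in the stable category. -/
def IsComparison {r : ℕ} {M N N' : Mod k C} (E : LongSeq r M N) (E' : LongSeq r M N')
    (α : N ⟶ N') : Prop :=
  ∃ φ : ∀ i, E.Y i ⟶ E'.Y i,
    E.ι ≫ φ ⟨0, Nat.succ_pos _⟩ = E'.ι ∧
    (∀ (i : ℕ) (h : i < r + 1),
      E.d i h ≫ φ ⟨i + 1, Nat.succ_lt_succ h⟩ = φ ⟨i, Nat.lt_succ_of_lt h⟩ ≫ E'.d i h) ∧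
    E.π ≫ α = φ ⟨r + 1, Nat.lt_succ_self _⟩ ≫ E'.π

variable (k C) in
/-- A choice, for every `M` in `mod C`, of a short exact sequence `0 ⟶ M ⟶ I M ⟶ Ω M ⟶ 0` with
`I M` projective(-injective); `Ω M` is written `Ω⁻¹ M` in the literature. -/
structure Cosyzygies where
  I : Mod k C → Mod k C
  Ω : Mod k C → Mod k C
  i : ∀ M, M ⟶ I M
  p : ∀ M, I M ⟶ Ω M
  projective : ∀ M, Projective (I M)
  inj : ∀ M, Inj (i M)
  exact : ∀ M, Exact (i M) (p M)
  surj : ∀ M, Surj (p M)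

namespace Cosyzygies

variable (c : Cosyzygies k C)

/-- The iterated cosyzygies `Ω⁻ʲ M`. -/
def iter (M : Mod k C) : ℕ → Mod k C
  | 0 => M
  | j + 1 => c.Ω (iter M j)

/-- The standard injective resolution
`M ⟶ I_M ⟶ I_{Ω⁻¹ M} ⟶ ⋯ ⟶ I_{Ω⁻⁽ⁿ⁻¹⁾ M} ⟶ Ω⁻ⁿ M`, with `n = r + 2`. -/
def resolution (r : ℕ) (M : Mod k C) : LongSeq r M (c.iter M (r + 2)) where
  Y j := c.I (c.iter M j)
  ι := c.i M
  d j _ := c.p (c.iter M j) ≫ c.i (c.iter M (j + 1))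
  π := c.p (c.iter M (r + 1))

end Cosyzygies

/-- An exact sequence `0 ⟶ Id ⟶ X 0 ⟶ ⋯ ⟶ X (r + 1) ⟶ Σ ⟶ 0` of exact endofunctors of `mod C`
where the `X i` take projective values. -/
structure FunctorSeq (r : ℕ) where
  X : Fin (r + 2) → (Mod k C ⥤ Mod k C)
  ι : 𝟭 (Mod k C) ⟶ X ⟨0, Nat.succ_pos _⟩
  d : ∀ (i : ℕ) (h : i < r + 1), X ⟨i, Nat.lt_succ_of_lt h⟩ ⟶ X ⟨i + 1, Nat.succ_lt_succ h⟩
  π : X ⟨r + 1, Nat.lt_succ_self _⟩ ⟶ shift S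
  preservesLimits : ∀ i, PreservesFiniteLimits (X i)
  preservesColimits : ∀ i, PreservesFiniteColimits (X i)
  projective : ∀ i M, Projective ((X i).obj M)
  exact : ∀ M, LongSeq.IsExact (r := r) (M := M) (N := (shift S).obj M)
    { Y := fun i => (X i).obj M
      ι := ι.app M
      d := fun i h => (d i h).app M
      π := π.app M }

variable {S}
variable {r : ℕ}

namespace FunctorSeq

variable (T : FunctorSeq (k := k) S r)

/-- The value `0 ⟶ M ⟶ X 0 M ⟶ ⋯ ⟶ X (r + 1) M ⟶ Σ M ⟶ 0` of the sequence at `M`. -/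
def eval (M : Mod k C) : LongSeq r M ((shift S).obj M) where
  Y i := (T.X i).obj M
  ι := T.ι.app M
  d i h := (T.d i h).app M
  π := T.π.app M

/-- The standard `n`-angle `T_M`, i.e. `X 0 M ⟶ ⋯ ⟶ X (r + 1) M ⟶ Σ (X 0 M)`, where the last arrow
is the composite `X (r + 1) M ⟶ Σ M ⟶ Σ (X 0 M)`. Its terms are projective objects of `mod C`. -/
def std (M : Mod k C) : NSeq (shift (k := k) S) r where
  X i := (T.X i).obj M
  d i h := (T.d i h).app M
  last := T.π.app M ≫ (shift S).map (T.ι.app M)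

end FunctorSeq

variable (k) in
/-- An `n`-`Σ`-sequence in `C`, viewed in `mod C` through the Yoneda embedding. -/
def toMod (X : NSeq S.functor r) : NSeq (shift (k := k) S) r :=
  X.map (yon k C) (yonShift S)

/-- The sequence `M ⟶ X 0 ⟶ ⋯ ⟶ X (r + 1) ⟶ Σ M` in `mod C` obtained from an
`n`-`Σ`-sequence `X` in `C`, a morphism `l : M ⟶ X 0` and a morphism `π : X (r + 1) ⟶ Σ M`. -/
def kerSeq (X : NSeq S.functor r) {M : Mod k C} (l : M ⟶ (toMod k X).X ⟨0, Nat.succ_pos _⟩)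
    (π : (toMod k X).X ⟨r + 1, Nat.lt_succ_self _⟩ ⟶ (shift S).obj M) :
    LongSeq r M ((shift S).obj M) where
  Y := (toMod k X).X
  ι := l
  d := (toMod k X).d
  π := π

/-- The `n`-`Σ`-complexes in the class `Φ`: if `l : M ⟶ X 0` is the kernel of the first arrow of `X`
and the last arrow of `X` is factored as `X (r + 1) ⟶ Σ M ⟶ Σ (X 0)`, then the comparison
`α : Σ M ⟶ Ω⁻ⁿ M` from the functor sequence and the comparison `β : Σ M ⟶ Ω⁻ⁿ M` from `X` are
equal in the stable category. -/
def Phi (c : Cosyzygies k C) (T : FunctorSeq (k := k) S r) :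
    ObjectProperty (NComplex S.functor r) := fun X =>
  ∃ (M : Mod k C) (l : M ⟶ (toMod k X.obj).X ⟨0, Nat.succ_pos _⟩)
    (π : (toMod k X.obj).X ⟨r + 1, Nat.lt_succ_self _⟩ ⟶ (shift S).obj M),
    Inj l ∧ Exact l ((toMod k X.obj).d 0 (Nat.succ_pos _)) ∧
    π ≫ (shift S).map l = (toMod k X.obj).last ∧
    ∃ α β : (shift S).obj M ⟶ c.iter M (r + 2),
      IsComparison (T.eval M) (c.resolution r M) α ∧
      IsComparison (kerSeq X.obj l π) (c.resolution r M) β ∧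
      (toStable (Mod k C)).map β = (toStable (Mod k C)).map α

/-- The `n`-`Σ`-complexes that are homotopy equivalent, via `n`-`Σ`-periodic homotopy, to a standard
`n`-angle. -/
def HtpyStandard (T : FunctorSeq (k := k) S r) : ObjectProperty (NComplex S.functor r) := fun X =>
  ∃ M : Mod k C, HomotopyEquivalent (toMod k X.obj) (T.std M)

end Modules

end NAngle

/-! In an exact sequence `0 ⟶ M ⟶ Y₁ ⟶ ⋯ ⟶ Yₙ ⟶ N ⟶ 0` with projective-injective middle terms, a
morphism on `M` determines the induced morphism on `N` stably, and the latter can be altered by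
any stably trivial morphism at the cost of changing the component at `Yₙ` only. Hence the
`Φ`-condition provides morphisms `f : X ⟶ T_M` and `g : T_M ⟶ X` that are the identity on both `M`
and `Σ M`. The morphism `fg - 1` vanishes on both ends, so it has a null-homotopy; this one need not
be periodic, but it makes the composite of two such morphisms null-homotopic through a periodic
homotopy. Consequently `2g - gfg` is a homotopy inverse of `f`.

Conversely, a homotopy equivalence `X ≃ T_N` makes `M = ker f₁` a stable retract of `N` through some
`p : M ⟶ N` and `q : N ⟶ M`, and evaluating the functor sequence at `q` shows that the comparison
morphism `β` of `X` is stably `Σ(pq) ≫ α = α`. -/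

namespace NAngle

section Modules

variable {k : Type w} [Field k] {C : Type u} [Category.{v} C] [Preadditive C] [Linear k C]
  {L L' M N N' P I : Mod k C}

/-! ### Representable modules -/

lemma comp_app_apply (f : L ⟶ M) (g : M ⟶ N) (W : Cᵒᵖ) (x : L.obj.obj W) :
    ((f ≫ g).hom.app W).hom x = (g.hom.app W).hom ((f.hom.app W).hom x) := rfl

lemma Mod.hom_ext_apply {f g : M ⟶ N}
    (h : ∀ W x, (f.hom.app W).hom x = (g.hom.app W).hom x) : f = g :=
  ObjectProperty.hom_ext _ (by ext W x; exact h W x)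

/-- The Yoneda correspondence between morphisms from a representable module to `M` and elements
of `M`, given by evaluation at the identity. -/
def yonEval {X : C} (f : (yon k C).obj X ⟶ M) : M.obj.obj (op X) :=
  (f.hom.app (op X)).hom (𝟙 X)

lemma app_eq_map_yonEval {X : C} (f : (yon k C).obj X ⟶ M) {W : Cᵒᵖ} (a : unop W ⟶ X) :
    (f.hom.app W).hom a = (M.obj.map a.op).hom (yonEval f) :=
  (congrArg (f.hom.app W).hom (Category.comp_id a).symm).trans
    (ConcreteCategory.congr_hom (f.hom.naturality a.op) (𝟙 X))

lemma yonEval_injective {X : C} :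
    Function.Injective (yonEval : ((yon k C).obj X ⟶ M) → M.obj.obj (op X)) := fun f g h =>
  Mod.hom_ext_apply fun W a => by
    rw [app_eq_map_yonEval f a, app_eq_map_yonEval g a, h]

lemma yonEval_surjective {X : C} :
    Function.Surjective (yonEval : ((yon k C).obj X ⟶ M) → M.obj.obj (op X)) := by
  intro x
  obtain ⟨_, Y, _, p, hp⟩ := M.property
  obtain ⟨y, rfl⟩ := (hp (op X)).2 x
  exact ⟨ObjectProperty.homMk ((linearYoneda k C).map (show X ⟶ Y from y) ≫ p),
    congrArg (p.app (op X)).hom (Category.id_comp (show X ⟶ Y from y))⟩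

variable (M) in
lemma exists_surj_yon : ∃ (Y : C) (p : (yon k C).obj Y ⟶ M), Surj p := by
  obtain ⟨_, Y, _, p, hp⟩ := M.property
  exact ⟨Y, ObjectProperty.homMk p, fun W => (hp W).2⟩

instance : (yon k C).Full :=
  inferInstanceAs ((finPres k C).lift (linearYoneda k C) finPres_yoneda).Full

/-! ### Pointwise and categorical exactness -/

lemma inj_iff_mono {f : M ⟶ N} : Inj f ↔ Mono f := by
  refine ⟨fun hf => ⟨fun a b h => Mod.hom_ext_apply fun W x => hf W ?_⟩, fun _ W x y h => ?_⟩
  · rw [← comp_app_apply, h, comp_app_apply]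
  · obtain ⟨a, rfl⟩ := yonEval_surjective (X := unop W) x
    obtain ⟨b, rfl⟩ := yonEval_surjective (X := unop W) y
    exact congrArg yonEval ((cancel_mono f).1 (yonEval_injective h))

lemma Surj.epi {f : M ⟶ N} (hf : Surj f) : Epi f := by
  refine ⟨fun a b h => Mod.hom_ext_apply fun W y => ?_⟩
  obtain ⟨x, rfl⟩ := hf W y
  rw [← comp_app_apply, h, comp_app_apply]

lemma Exact.comp_eq_zero {f : L ⟶ M} {g : M ⟶ N} (h : Exact f g) : f ≫ g = 0 :=
  Mod.hom_ext_apply fun W => (h W).apply_apply_eq_zero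

lemma exact_iff {f : L ⟶ M} {g : M ⟶ N} :
    Exact f g ↔ f ≫ g = 0 ∧ ∀ (X : C) (a : (yon k C).obj X ⟶ M), a ≫ g = 0 →
      ∃ b : (yon k C).obj X ⟶ L, b ≫ f = a := by
  refine ⟨fun h => ⟨h.comp_eq_zero, fun X a ha => ?_⟩, fun ⟨w, h⟩ W y => ⟨fun hy => ?_, ?_⟩⟩
  · obtain ⟨x, hx⟩ := (h (op X) (yonEval a)).1 (congrArg yonEval ha)
    obtain ⟨b, rfl⟩ := yonEval_surjective x
    exact ⟨b, yonEval_injective hx⟩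
  · obtain ⟨a, rfl⟩ := yonEval_surjective (X := unop W) y
    obtain ⟨b, rfl⟩ := h _ a (yonEval_injective hy)
    exact ⟨yonEval b, rfl⟩
  · rintro ⟨x, rfl⟩
    rw [← comp_app_apply, w]
    rfl

lemma Inj.exact_comp_iff {f : L ⟶ M} {g : M ⟶ N} {j : N ⟶ N'} (hj : Inj j) :
    Exact f (g ≫ j) ↔ Exact f g :=
  forall_congr' fun W => (hj W).comp_exact_iff_exact

lemma Surj.comp_exact_iff {q : L' ⟶ L} {f : L ⟶ M} {g : M ⟶ N} (hq : Surj q) :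
    Exact (q ≫ f) g ↔ Exact f g :=
  forall_congr' fun W => (hq W).comp_exact_iff_exact

lemma Exact.of_comp_iso_hom {M' : Mod k C} {f : L ⟶ M} {e : M ≅ M'} {g : M' ⟶ N}
    (h : Exact f (e.hom ≫ g)) : Exact (f ≫ e.hom) g :=
  exact_iff.2 ⟨(Category.assoc _ _ _).trans h.comp_eq_zero, fun X a ha => by
    obtain ⟨b, hb⟩ := (exact_iff.1 h).2 X (a ≫ e.inv) (by simpa using ha)
    exact ⟨b, by simp [reassoc_of% hb]⟩⟩

lemma surj_of_exact_comp {q : L' ⟶ L} {j : L ⟶ M} {g : M ⟶ N}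
    (hj : Inj j) (w : j ≫ g = 0) (h : Exact (q ≫ j) g) : Surj q := by
  intro W x
  obtain ⟨x', hx'⟩ := (h W ((j.hom.app W).hom x)).1 (by rw [← comp_app_apply, w]; rfl)
  exact ⟨x', hj W hx'⟩

/-- The abelian category structure carried by a Frobenius category. -/
abbrev IsFrobenius.abelian {A : Type u₁} [Category.{v₁} A] [Preadditive A] (h : IsFrobenius A) :
    Abelian A :=
  have := h.hasFiniteProducts
  have := h.hasKernels
  have := h.hasCokernels
  have := h.normalMono
  have := h.normalEpi
  { }

lemma Exact.shortComplex_exact (hFrob : IsFrobenius (Mod k C)) {f : L ⟶ M} {g : M ⟶ N}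
    (h : Exact f g) : (ShortComplex.mk f g h.comp_eq_zero).Exact := by
  let _ := hFrob.abelian
  rw [ShortComplex.exact_iff_exact_up_to_refinements]
  intro A x hx
  obtain ⟨Y, p, hp⟩ := exists_surj_yon A
  obtain ⟨b, hb⟩ := (exact_iff.1 h).2 Y (p ≫ x) (by rw [Category.assoc, hx, comp_zero])
  exact ⟨_, p, hp.epi, b, hb.symm⟩

lemma exists_inj_exact (hFrob : IsFrobenius (Mod k C)) (g : M ⟶ N) :
    ∃ (K : Mod k C) (l : K ⟶ M), Inj l ∧ Exact l g :=
  have := hFrob.hasKernels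
  ⟨kernel g, kernel.ι g, inj_iff_mono.2 inferInstance, exact_iff.2 ⟨kernel.condition g,
    fun _ a ha => ⟨kernel.lift g a ha, kernel.lift_ι g a ha⟩⟩⟩

/-! ### Projective modules, lifting and extension -/

lemma exists_section_of_epi_yon_map {X Y : C} (g : X ⟶ Y) [Epi ((yon k C).map g)] :
    ∃ s : Y ⟶ X, s ≫ g = 𝟙 Y := by
  -- The pointwise cokernel of `g` is finitely presented, hence an object of `mod C`.
  let q := cokernel.π ((linearYoneda k C).map g)
  have hq (W : Cᵒᵖ) : Function.Exact (((linearYoneda k C).map g).app W).hom (q.app W).hom :=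
    (ShortComplex.ShortExact.moduleCat_exact_iff_function_exact _).1
      ((ShortComplex.exact_cokernel ((linearYoneda k C).map g)).map ((evaluation _ _).obj W))
  have hq_epi (W : Cᵒᵖ) : Epi (q.app W) :=
    inferInstanceAs (Epi (((evaluation _ _).obj W).map q))
  let Q : Mod k C :=
    ⟨_, X, Y, g, q, fun W => ⟨hq W, (ModuleCat.epi_iff_surjective _).1 (hq_epi W)⟩⟩
  have hq_zero : (ObjectProperty.homMk q : (yon k C).obj Y ⟶ Q) = 0 := by
    rw [← cancel_epi ((yon k C).map g), comp_zero]
    exact ObjectProperty.hom_ext _ (cokernel.condition _)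
  exact (hq (op Y) (𝟙 Y)).1 (congrArg yonEval hq_zero)

lemma projective_yon (hFrob : IsFrobenius (Mod k C)) (X : C) :
    Projective ((yon k C).obj X) where
  factors {E N} a e _ := by
    let _ := hFrob.abelian
    obtain ⟨B, b, _, x, hx⟩ := surjective_up_to_refinements_of_epi e a
    obtain ⟨Y, p, hp⟩ := exists_surj_yon B
    have := hp.epi
    obtain ⟨g, hg⟩ := (yon k C).map_surjective (p ≫ b)
    have : Epi ((yon k C).map g) := hg ▸ inferInstance
    obtain ⟨s, hs⟩ := exists_section_of_epi_yon_map (k := k) g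
    exact ⟨(yon k C).map s ≫ p ≫ x, by
      rw [Category.assoc, Category.assoc, ← hx, ← Category.assoc p, ← hg, ← Category.assoc,
        ← Functor.map_comp, hs, CategoryTheory.Functor.map_id, Category.id_comp]⟩

lemma Exact.exists_extension (hFrob : IsFrobenius (Mod k C)) {f : L ⟶ M} {g : M ⟶ N}
    (h : Exact f g) (hI : Projective I) (u : M ⟶ I) (hu : f ≫ u = 0) : ∃ v : N ⟶ I, g ≫ v = u :=
  let _ := hFrob.abelian
  have : Injective I := (hFrob.projective_iff_injective I).1 hI
  ⟨(h.shortComplex_exact hFrob).descToInjective u hu,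
    (h.shortComplex_exact hFrob).comp_descToInjective u hu⟩

lemma Inj.exists_extension (hFrob : IsFrobenius (Mod k C)) {f : M ⟶ N} (h : Inj f)
    (hI : Projective I) (u : M ⟶ I) : ∃ v : N ⟶ I, f ≫ v = u :=
  have : Injective I := (hFrob.projective_iff_injective I).1 hI
  have := inj_iff_mono.1 h
  ⟨Injective.factorThru u f, Injective.comp_factorThru u f⟩

lemma Exact.exists_desc (hFrob : IsFrobenius (Mod k C)) {f : L ⟶ M} {g : M ⟶ N}
    (h : Exact f g) (hg : Surj g) (u : M ⟶ I) (hu : f ≫ u = 0) : ∃ v : N ⟶ I, g ≫ v = u :=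
  let _ := hFrob.abelian
  have : Epi g := hg.epi
  ⟨(h.shortComplex_exact hFrob).desc u hu, (h.shortComplex_exact hFrob).g_desc u hu⟩

lemma Exact.exists_lift (hFrob : IsFrobenius (Mod k C)) {f : L ⟶ M} {g : M ⟶ N}
    (h : Exact f g) (hf : Inj f) (u : P ⟶ M) (hu : u ≫ g = 0) : ∃ v : P ⟶ L, v ≫ f = u :=
  let _ := hFrob.abelian
  have : Mono f := inj_iff_mono.1 hf
  ⟨(h.shortComplex_exact hFrob).lift u hu, (h.shortComplex_exact hFrob).lift_f u hu⟩

lemma Surj.exists_lift [Projective P] {g : M ⟶ N} (hg : Surj g) (u : P ⟶ N) :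
    ∃ v : P ⟶ M, v ≫ g = u :=
  have := hg.epi
  ⟨Projective.factorThru u g, Projective.factorThru_comp u g⟩

/-! ### The shift -/

section Shift

variable {S : C ≌ C} [S.functor.Additive] [S.functor.Linear k]

lemma isEquivalence_whiskeringLeft_inverse_op {B : Type u} [Category.{v} B] (S : B ≌ B) :
    ((Functor.whiskeringLeft _ _ (ModuleCat.{v} k)).obj S.inverse.op).IsEquivalence :=
  inferInstanceAs (S.op.congrLeft (E := ModuleCat.{v} k)).functor.IsEquivalence

instance : (shift (k := k) S).Additive where
  map_add := rfl

instance : (shift (k := k) S).Full :=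
  have := isEquivalence_whiskeringLeft_inverse_op (k := k) S
  inferInstanceAs (ObjectProperty.lift _ _ _).Full

instance : (shift (k := k) S).Faithful :=
  have := isEquivalence_whiskeringLeft_inverse_op (k := k) S
  inferInstanceAs (ObjectProperty.lift _ _ _).Faithful

instance : (shift (k := k) S).EssSurj where
  mem_essImage M := by
    have : S.symm.functor.Additive := S.inverse_additive
    have : S.symm.functor.Linear k := S.inverseLinear k
    let N : Mod k C := ⟨S.functor.op ⋙ M.obj, finPres_shift S.symm M.property⟩
    exact ⟨N, ⟨(finPres k C).isoMk (Functor.isoWhiskerRight (NatIso.op S.counitIso.symm) M.obj)⟩⟩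

instance : (shift (k := k) S).IsEquivalence where

lemma Inj.shift_map {f : M ⟶ N} (h : Inj f) : Inj ((shift S).map f) :=
  fun W => h (op (S.inverse.obj (unop W)))

lemma Exact.shift_map {f : L ⟶ M} {g : M ⟶ N} (h : Exact f g) :
    Exact ((shift S).map f) ((shift S).map g) :=
  fun W => h (op (S.inverse.obj (unop W)))

end Shift

end Modules

/-! ### The stable category -/

section Stable

variable {A : Type u₁} [Category.{v₁} A] [Preadditive A]

instance congruence_stableRel [HasZeroObject A] [HasBinaryBiproducts A] :
    Congruence (stableRel A) where
  comp_left e := by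
    rintro _ _ ⟨P, hP, a, b, h⟩
    exact ⟨P, hP, e ≫ a, b, by rw [← Preadditive.comp_sub, h, Category.assoc]⟩
  comp_right e := by
    rintro ⟨P, hP, a, b, h⟩
    exact ⟨P, hP, a, b ≫ e, by rw [← Preadditive.sub_comp, h, Category.assoc]⟩
  equivalence :=
    { refl := fun f =>
        have ⟨Z, hZ⟩ := HasZeroObject.zero (C := A)
        ⟨Z, hZ.projective, 0, 0, by simp⟩
      symm := fun ⟨P, hP, a, b, h⟩ =>
        ⟨P, hP, -a, b, by rw [Preadditive.neg_comp, ← h, neg_sub]⟩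
      trans := fun ⟨P, _, a, b, h⟩ ⟨P', _, a', b', h'⟩ =>
        ⟨P ⊞ P', inferInstance, biprod.lift a a', biprod.desc b b', by
          rw [biprod.lift_desc, ← h, ← h', sub_add_sub_cancel]⟩ }

lemma toStable_map_eq_iff (hA : IsFrobenius A) {M N : A} {f g : M ⟶ N} :
    (toStable A).map f = (toStable A).map g ↔ stableRel A f g :=
  let _ := hA.abelian
  have := Abelian.hasFiniteBiproducts (C := A)
  have := hasBinaryBiproducts_of_finite_biproducts A
  CategoryTheory.Quotient.functor_map_eq_iff _ _ _

lemma toStable_map_eq_of_functor_map {B : Type u₂} [Category.{v₂} B] [Preadditive B]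
    (hB : IsFrobenius B) (F : A ⥤ B) [F.Additive] [F.IsEquivalence] {M N : A} {f g : M ⟶ N}
    (h : (toStable B).map (F.map f) = (toStable B).map (F.map g)) :
    (toStable A).map f = (toStable A).map g := by
  obtain ⟨P, hP, a, b, hab⟩ := (toStable_map_eq_iff hB).1 h
  let e := F.objObjPreimageIso P
  have hP' : Projective (F.objPreimage P) :=
    (F.asEquivalence.map_projective_iff _).1 (Projective.of_iso e.symm hP)
  exact CategoryTheory.Quotient.sound _ ⟨_, hP', F.preimage (a ≫ e.inv), F.preimage (e.hom ≫ b),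
    F.map_injective (by simp [hab])⟩

end Stable

/-! ### The comparison theorem -/

lemma exists_seq_of_forall_exists_succ {n : ℕ} {F : ∀ i, i < n → Type*} (P : ∀ i h, F i h → Prop)
    (R : ∀ i (h : i + 1 < n), F i (Nat.lt_of_succ_lt h) → F (i + 1) h → Prop)
    (h0 : 0 < n) (x0 : F 0 h0) (hx0 : P 0 h0 x0)
    (step : ∀ i (h : i + 1 < n) x, P i (Nat.lt_of_succ_lt h) x →
      ∃ y, P (i + 1) h y ∧ R i h x y) :
    ∃ f : ∀ i h, F i h, f 0 h0 = x0 ∧ (∀ i h, P i h (f i h)) ∧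
      ∀ i h, R i h (f i (Nat.lt_of_succ_lt h)) (f (i + 1) h) := by
  choose g hg using step
  let s : ∀ i (h : i < n), {x : F i h // P i h x} := fun i =>
    Nat.rec (motive := fun i => ∀ h : i < n, {x : F i h // P i h x}) (fun _ => ⟨x0, hx0⟩)
      (fun i ih h => ⟨g i h (ih _).1 (ih _).2, (hg i h (ih _).1 (ih _).2).1⟩) i
  exact ⟨fun i h => (s i h).1, rfl, fun i h => (s i h).2,
    fun i h => (hg i h (s i _).1 (s i _).2).2⟩

section Modules

variable {k : Type w} [Field k] {C : Type u} [Category.{v} C] [Preadditive C] [Linear k C]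

namespace LongSeq

variable {r : ℕ} {M M' M'' N N' N'' : Mod k C}

/-- Morphisms of sequences with prescribed components `u` and `α` at the ends. -/
structure Map (E : LongSeq r M N) (E' : LongSeq r M' N') (u : M ⟶ M') (α : N ⟶ N') where
  φ : ∀ i, E.Y i ⟶ E'.Y i
  comm_ι : E.ι ≫ φ ⟨0, Nat.succ_pos _⟩ = u ≫ E'.ι
  comm_d : ∀ (i : ℕ) (h : i < r + 1),
    E.d i h ≫ φ ⟨i + 1, Nat.succ_lt_succ h⟩ = φ ⟨i, Nat.lt_succ_of_lt h⟩ ≫ E'.d i h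
  comm_π : E.π ≫ α = φ ⟨r + 1, Nat.lt_succ_self _⟩ ≫ E'.π

lemma isComparison_iff {E : LongSeq r M N} {E' : LongSeq r M N'} {α : N ⟶ N'} :
    IsComparison E E' α ↔ Nonempty (Map E E' (𝟙 M) α) := by
  constructor
  · rintro ⟨φ, hι, hd, hπ⟩
    exact ⟨⟨φ, by rw [hι, Category.id_comp], hd, hπ⟩⟩
  · rintro ⟨φ, hι, hd, hπ⟩
    exact ⟨φ, by rw [hι, Category.id_comp], hd, hπ⟩

namespace Map

variable {E : LongSeq r M N} {E' : LongSeq r M' N'} {E'' : LongSeq r M'' N''}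
  {u u' : M ⟶ M'} {α α' : N ⟶ N'}

/-- The identity of a sequence. -/
@[simps]
def id (E : LongSeq r M N) : Map E E (𝟙 M) (𝟙 N) where
  φ _ := 𝟙 _
  comm_ι := by rw [Category.comp_id, Category.id_comp]
  comm_d _ _ := by rw [Category.comp_id, Category.id_comp]
  comm_π := by rw [Category.comp_id, Category.id_comp]

/-- The composite of two morphisms of sequences. -/
@[simps]
def comp {v : M' ⟶ M''} {β : N' ⟶ N''} (f : Map E E' u α) (g : Map E' E'' v β) :
    Map E E'' (u ≫ v) (α ≫ β) where
  φ i := f.φ i ≫ g.φ i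
  comm_ι := by rw [← Category.assoc, f.comm_ι, Category.assoc, g.comm_ι, Category.assoc]
  comm_d i h := by rw [← Category.assoc, f.comm_d, Category.assoc, g.comm_d, Category.assoc]
  comm_π := by rw [← Category.assoc, f.comm_π, Category.assoc, g.comm_π, Category.assoc]

/-- The difference of two morphisms of sequences. -/
@[simps]
def sub (f : Map E E' u α) (g : Map E E' u' α') : Map E E' (u - u') (α - α') where
  φ i := f.φ i - g.φ i
  comm_ι := by rw [Preadditive.comp_sub, f.comm_ι, g.comm_ι, Preadditive.sub_comp]
  comm_d i h := by rw [Preadditive.comp_sub, f.comm_d, g.comm_d, Preadditive.sub_comp]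
  comm_π := by rw [Preadditive.comp_sub, f.comm_π, g.comm_π, Preadditive.sub_comp]

/-- A null-homotopy of a morphism of the complexes `M ⟶ Y 0 ⟶ ⋯ ⟶ Y (r + 1) ⟶ N`, with components
`left : Y 0 ⟶ M'`, `h i : Y (i + 1) ⟶ Y' i` and `right : N ⟶ Y' (r + 1)`. -/
structure Nullhomotopy (f : Map E E' u α) where
  left : E.Y ⟨0, Nat.succ_pos _⟩ ⟶ M'
  h : ∀ (i : ℕ) (hi : i < r + 1),
    E.Y ⟨i + 1, Nat.succ_lt_succ hi⟩ ⟶ E'.Y ⟨i, Nat.lt_succ_of_lt hi⟩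
  right : N ⟶ E'.Y ⟨r + 1, Nat.lt_succ_self _⟩
  ι_left : E.ι ≫ left = u
  φ_zero : f.φ ⟨0, Nat.succ_pos _⟩ =
    E.d 0 (Nat.succ_pos _) ≫ h 0 (Nat.succ_pos _) + left ≫ E'.ι
  φ_succ : ∀ (i : ℕ) (hi : i < r), f.φ ⟨i + 1, Nat.lt_succ_of_lt (Nat.succ_lt_succ hi)⟩ =
    E.d (i + 1) (Nat.succ_lt_succ hi) ≫ h (i + 1) (Nat.succ_lt_succ hi) +
      h i (Nat.lt_succ_of_lt hi) ≫ E'.d i (Nat.lt_succ_of_lt hi)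
  φ_last : f.φ ⟨r + 1, Nat.lt_succ_self _⟩ =
    E.π ≫ right + h r (Nat.lt_succ_self _) ≫ E'.d r (Nat.lt_succ_self _)
  right_π : right ≫ E'.π = α

end Map

/-! The terms of the target are projective, hence injective, so the components of a morphism or of
a null-homotopy are found one after the other, from left to right. -/

section Construction

variable {E : LongSeq r M N} {E' : LongSeq r M' N'}

lemma exists_map (hFrob : IsFrobenius (Mod k C)) (hE : E.IsExact) (hE' : E'.IsExact)
    (hP : ∀ i, Projective (E'.Y i)) (u : M ⟶ M') : ∃ α, Nonempty (Map E E' u α) := by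
  obtain ⟨φ₀, hφ₀⟩ := hE.inj.exists_extension hFrob (hP _) (u ≫ E'.ι)
  obtain ⟨φ, rfl, -, hφ⟩ := exists_seq_of_forall_exists_succ
    (F := fun i h => E.Y ⟨i, h⟩ ⟶ E'.Y ⟨i, h⟩)
    (fun i h x => ∀ h' : i < r + 1, ∃ y, E.d i h' ≫ y = x ≫ E'.d i h')
    (fun i h x y => E.d i (Nat.lt_of_succ_lt_succ h) ≫ y =
      x ≫ E'.d i (Nat.lt_of_succ_lt_succ h))
    (Nat.succ_pos _) φ₀
    (fun _ => hE.exact_ι.exists_extension hFrob (hP _) _ (by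
      rw [← Category.assoc, hφ₀, Category.assoc, hE'.exact_ι.comp_eq_zero, comp_zero]))
    (by
      intro i h x hx
      obtain ⟨y, hy⟩ := hx (Nat.lt_of_succ_lt_succ h)
      refine ⟨y, fun h' => ?_, hy⟩
      refine (hE.exact_d i (Nat.lt_of_succ_lt_succ h')).exists_extension hFrob (hP _) _ ?_
      rw [← Category.assoc, hy, Category.assoc,
        (hE'.exact_d i (Nat.lt_of_succ_lt_succ h')).comp_eq_zero, comp_zero])
  obtain ⟨α, hα⟩ := hE.exact_π.exists_desc hFrob hE.surj (φ (r + 1) (Nat.lt_succ_self _) ≫ E'.π)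
    (by rw [← Category.assoc, hφ r (Nat.lt_succ_self _), Category.assoc,
      hE'.exact_π.comp_eq_zero, comp_zero])
  exact ⟨α, ⟨⟨fun i => φ i.1 i.2, hφ₀, fun i h => hφ i (Nat.succ_lt_succ h), hα⟩⟩⟩

namespace Map

variable {u u' : M ⟶ M'} {α α' : N ⟶ N'}

lemma exists_nullhomotopy (hFrob : IsFrobenius (Mod k C)) (hE : E.IsExact) (hE' : E'.IsExact)
    (hP : ∀ i, Projective (E'.Y i)) (f : Map E E' u α)
    (left : E.Y ⟨0, Nat.succ_pos _⟩ ⟶ M') (ι_left : E.ι ≫ left = u) :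
    Nonempty f.Nullhomotopy := by
  obtain ⟨h₀, hh₀⟩ := hE.exact_ι.exists_extension hFrob (hP _)
    (f.φ ⟨0, Nat.succ_pos _⟩ - left ≫ E'.ι)
    (by rw [Preadditive.comp_sub, f.comm_ι, ← Category.assoc, ι_left, sub_self])
  obtain ⟨h, rfl, hd, hφ⟩ := exists_seq_of_forall_exists_succ (n := r + 1)
    (F := fun i hi => E.Y ⟨i + 1, Nat.succ_lt_succ hi⟩ ⟶ E'.Y ⟨i, Nat.lt_succ_of_lt hi⟩)
    (fun i hi x => (f.φ ⟨i, Nat.lt_succ_of_lt hi⟩ - E.d i hi ≫ x) ≫ E'.d i hi = 0)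
    (fun i hi x y => f.φ ⟨i + 1, Nat.lt_succ_of_lt hi⟩ =
      E.d (i + 1) hi ≫ y + x ≫ E'.d i (Nat.lt_of_succ_lt hi))
    (Nat.succ_pos _) h₀
    (by rw [hh₀, sub_sub_cancel, Category.assoc, hE'.exact_ι.comp_eq_zero, comp_zero])
    (by
      intro i hi x hx
      obtain ⟨y, hy⟩ := (hE.exact_d i (Nat.lt_of_succ_lt_succ hi)).exists_extension hFrob (hP _)
        (f.φ ⟨i + 1, Nat.lt_succ_of_lt hi⟩ - x ≫ E'.d i (Nat.lt_of_succ_lt hi))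
        (by rw [Preadditive.comp_sub, f.comm_d, ← Category.assoc, ← Preadditive.sub_comp, hx])
      refine ⟨y, ?_, by rw [hy, sub_add_cancel]⟩
      rw [hy, sub_sub_cancel, Category.assoc,
        (hE'.exact_d i (Nat.lt_of_succ_lt_succ hi)).comp_eq_zero, comp_zero])
  obtain ⟨right, hright⟩ := hE.exact_π.exists_desc hFrob hE.surj
    (f.φ ⟨r + 1, Nat.lt_succ_self _⟩ - h r (Nat.lt_succ_self _) ≫ E'.d r (Nat.lt_succ_self _))
    (by rw [Preadditive.comp_sub, f.comm_d, ← Category.assoc, ← Preadditive.sub_comp,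
      hd r (Nat.lt_succ_self _)])
  have := hE.surj.epi
  exact ⟨{
    left, h, right, ι_left
    φ_zero := by rw [hh₀, sub_add_cancel]
    φ_succ := fun i hi => hφ i (Nat.succ_lt_succ hi)
    φ_last := by rw [hright, sub_add_cancel]
    right_π := by
      rw [← cancel_epi E.π, f.comm_π, ← Category.assoc, hright, Preadditive.sub_comp,
        Category.assoc, hE'.exact_π.comp_eq_zero, comp_zero, sub_zero] }⟩

lemma toStable_map_right_eq (hFrob : IsFrobenius (Mod k C)) (hE : E.IsExact)
    (hE' : E'.IsExact) (hP : ∀ i, Projective (E'.Y i)) (f : Map E E' u α) (f' : Map E E' u' α')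
    (h : (toStable (Mod k C)).map u = (toStable (Mod k C)).map u') :
    (toStable (Mod k C)).map α = (toStable (Mod k C)).map α' := by
  obtain ⟨P, hP', a, b, hab⟩ := (toStable_map_eq_iff hFrob).1 h
  obtain ⟨a', ha'⟩ := hE.inj.exists_extension hFrob hP' a
  obtain ⟨H⟩ := (f.sub f').exists_nullhomotopy hFrob hE hE' hP (a' ≫ b)
    (by rw [← Category.assoc, ha', hab])
  exact CategoryTheory.Quotient.sound _ ⟨_, hP _, H.right, E'.π, H.right_π.symm⟩

/-- Subtracting `δ` from the last component of a morphism of sequences. -/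
def subLast (f : Map E E' u α) (hd : E.d r (Nat.lt_succ_self _) ≫ E.π = 0)
    (δ : N ⟶ E'.Y ⟨r + 1, Nat.lt_succ_self _⟩) : Map E E' u (α - δ ≫ E'.π) where
  φ := Function.update f.φ ⟨r + 1, Nat.lt_succ_self _⟩ (f.φ _ - E.π ≫ δ)
  comm_ι := by rw [Function.update_of_ne (by simp), f.comm_ι]
  comm_d i h := by
    have hi : (⟨i, Nat.lt_succ_of_lt h⟩ : Fin (r + 2)) ≠ ⟨r + 1, Nat.lt_succ_self _⟩ :=
      Fin.ne_of_lt h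
    rw [Function.update_of_ne hi, ← f.comm_d]
    obtain rfl | hi := eq_or_ne i r
    · rw [Function.update_self, Preadditive.comp_sub, ← Category.assoc, hd, zero_comp, sub_zero]
    · rw [Function.update_of_ne (by simpa using hi)]
  comm_π := by
    rw [Function.update_self, Preadditive.comp_sub, f.comm_π, Preadditive.sub_comp,
      Category.assoc]

end Map

end Construction

lemma Map.exists_right_eq (hFrob : IsFrobenius (Mod k C)) {E : LongSeq r M N} (hE : E.IsExact)
    {E' : LongSeq r M' N'} (hE' : E'.IsExact) {u : M ⟶ M'} {α α' : N ⟶ N'}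
    (f : Map E E' u α) (h : (toStable (Mod k C)).map α = (toStable (Mod k C)).map α') :
    Nonempty (Map E E' u α') := by
  obtain ⟨P, hP, a, b, hab⟩ := (toStable_map_eq_iff hFrob).1 h
  obtain ⟨c, rfl⟩ := hE'.surj.exists_lift b
  have hα' : α - (a ≫ c) ≫ E'.π = α' := by rw [Category.assoc, ← hab, sub_sub_cancel]
  exact ⟨hα' ▸ f.subLast hE.exact_π.comp_eq_zero (a ≫ c)⟩

lemma exists_map_id_id (hFrob : IsFrobenius (Mod k C)) {E E' : LongSeq r M N}
    (hE : E.IsExact) (hE' : E'.IsExact) (hP' : ∀ i, Projective (E'.Y i))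
    {R : LongSeq r M N'} (hR : R.IsExact) {α β : N ⟶ N'}
    (f : Map E R (𝟙 M) α) (g : Map E' R (𝟙 M) β)
    (h : (toStable (Mod k C)).map α = (toStable (Mod k C)).map β) :
    Nonempty (Map E E' (𝟙 M) (𝟙 N)) := by
  obtain ⟨δ, ⟨e⟩⟩ := exists_map hFrob hR hE' hP' (𝟙 M)
  have hβδ : (toStable (Mod k C)).map (β ≫ δ) = (toStable (Mod k C)).map (𝟙 N) :=
    (g.comp e).toStable_map_right_eq hFrob hE' hE' hP' (Map.id E') (by rw [Category.comp_id])
  have hαδ : (toStable (Mod k C)).map (α ≫ δ) = (toStable (Mod k C)).map (𝟙 N) := by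
    rw [← hβδ, Functor.map_comp, h, ← Functor.map_comp]
  simpa only [Category.comp_id] using (f.comp e).exists_right_eq hFrob hE hE' hαδ

end LongSeq

end Modules

/-! ### Splicing and periodic homotopies -/

section Modules

variable {k : Type w} [Field k] {C : Type u} [Category.{v} C] [Preadditive C] [Linear k C]

lemma Cosyzygies.resolution_isExact (c : Cosyzygies k C) (r : ℕ) (M : Mod k C) :
    (c.resolution r M).IsExact where
  inj := c.inj _
  exact_ι := (c.inj _).exact_comp_iff.2 (c.exact _)
  exact_d _ _ := (c.surj _).comp_exact_iff.2 ((c.inj _).exact_comp_iff.2 (c.exact _))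
  exact_π := (c.surj _).comp_exact_iff.2 (c.exact _)
  surj := c.surj _

variable {S : C ≌ C} [S.functor.Additive] [S.functor.Linear k] {r : ℕ} {M M' M'' : Mod k C}

namespace LongSeq

/-- The periodic sequence `Y 0 ⟶ ⋯ ⟶ Y (r + 1) ⟶ Σ (Y 0)` spliced from
`M ⟶ Y 0 ⟶ ⋯ ⟶ Y (r + 1) ⟶ Σ M`. -/
abbrev toNSeq (E : LongSeq r M ((shift S).obj M)) : NSeq (shift (k := k) S) r where
  X := E.Y
  d := E.d
  last := E.π ≫ (shift S).map E.ι

namespace Map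

/-- The periodic morphism given by a morphism of sequences whose end components are `u` and
`Σ u`. -/
def toNSeq {E : LongSeq r M ((shift S).obj M)} {E' : LongSeq r M' ((shift S).obj M')}
    {u : M ⟶ M'} {α : (shift S).obj M ⟶ (shift S).obj M'} (f : Map E E' u α)
    (hα : α = (shift S).map u) : E.toNSeq ⟶ E'.toNSeq :=
  NSeq.Hom.mk f.φ f.comm_d <| by
    change (E.π ≫ (shift S).map E.ι) ≫ _ = _ ≫ E'.π ≫ (shift S).map E'.ι
    rw [Category.assoc, ← Functor.map_comp, f.comm_ι, Functor.map_comp, ← hα, ← Category.assoc,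
      f.comm_π, Category.assoc]

lemma homotopic_of_sub_eq_comp {E : LongSeq r M ((shift S).obj M)}
    {E' : LongSeq r M' ((shift S).obj M')} {E'' : LongSeq r M'' ((shift S).obj M'')}
    (hE : E.d r (Nat.lt_succ_self _) ≫ E.π = 0)
    {u : M ⟶ M'} {α : (shift S).obj M ⟶ (shift S).obj M'} {m : Map E E' u α}
    (H : m.Nullhomotopy) (hα : α = 0)
    {u' : M' ⟶ M''} {α' : (shift S).obj M' ⟶ (shift S).obj M''} {m' : Map E' E'' u' α'}
    (H' : m'.Nullhomotopy) (hu' : u' = 0)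
    {v w : M ⟶ M''} {β γ : (shift S).obj M ⟶ (shift S).obj M''} {f : Map E E'' v β}
    {g : Map E E'' w γ} (hβ : β = (shift S).map v) (hγ : γ = (shift S).map w)
    (h : ∀ i, f.φ i - g.φ i = m.φ i ≫ m'.φ i) : Homotopic (f.toNSeq hβ) (g.toNSeq hγ) := by
  subst hα hu'
  obtain ⟨t, ht, ht_last⟩ : ∃ t : ∀ i (hi : i < r + 1),
      E.Y ⟨i + 1, Nat.succ_lt_succ hi⟩ ⟶ E''.Y ⟨i, Nat.lt_succ_of_lt hi⟩,
      (∀ i (hi : i < r), t i (Nat.lt_succ_of_lt hi) = H.h i (Nat.lt_succ_of_lt hi) ≫ m'.φ _) ∧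
      t r (Nat.lt_succ_self _) = E.π ≫ H.right ≫ H'.h r (Nat.lt_succ_self _) +
        H.h r (Nat.lt_succ_self _) ≫ m'.φ _ :=
    ⟨Function.update (fun i hi => H.h i hi ≫ m'.φ _) r
      (fun hr => E.π ≫ H.right ≫ H'.h r hr + H.h r hr ≫ m'.φ _),
      fun i hi => by rw [Function.update_of_ne hi.ne], by rw [Function.update_self]⟩
  have d_t (i : ℕ) (hi : i < r + 1) : E.d i hi ≫ t i hi = E.d i hi ≫ H.h i hi ≫ m'.φ _ := by
    obtain hi' | rfl := Nat.lt_succ_iff_lt_or_eq.1 hi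
    · rw [ht i hi']
    · rw [ht_last, Preadditive.comp_add, reassoc_of% hE, zero_comp, zero_add]
  have right_φ : H.right ≫ m'.φ _ =
      H.right ≫ H'.h r (Nat.lt_succ_self _) ≫ E''.d r (Nat.lt_succ_self _) := by
    rw [H'.φ_last, Preadditive.comp_add, reassoc_of% H.right_π, zero_comp, zero_add]
  refine ⟨t, 0, fun i hi => (h _).trans ?_, (h _).trans ?_, ?_⟩
  · rw [H.φ_succ i hi, ht i hi]
    simp only [Preadditive.add_comp, Category.assoc, m'.comm_d, d_t]
  · rw [H.φ_last, ht_last, comp_zero, zero_add]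
    simp only [Preadditive.add_comp, Category.assoc, m'.comm_d, right_φ]
  · rw [zero_comp, add_zero, d_t]
    refine congrArg (shift S).map ((h _).trans ?_)
    rw [H.φ_zero, Preadditive.add_comp, Category.assoc, Category.assoc, m'.comm_ι, zero_comp,
      comp_zero, add_zero]

lemma homotopic_id (hFrob : IsFrobenius (Mod k C)) {E : LongSeq r M ((shift S).obj M)}
    (hE : E.IsExact) (hP : ∀ i, Projective (E.Y i)) {u v : M ⟶ M}
    {α β : (shift S).obj M ⟶ (shift S).obj M} {x : Map E E u α} (hu : u = 𝟙 M) (hα : α = 𝟙 _)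
    {y : Map E E v β} (hβ : β = (shift S).map v)
    (h : ∀ i, y.φ i - 𝟙 _ = (𝟙 _ - x.φ i) ≫ (x.φ i - 𝟙 _)) :
    Homotopic (y.toNSeq hβ) (𝟙 E.toNSeq) := by
  obtain ⟨H⟩ := ((id E).sub x).exists_nullhomotopy hFrob hE hE hP 0
    (by rw [comp_zero, hu, sub_self])
  obtain ⟨H'⟩ := (x.sub (id E)).exists_nullhomotopy hFrob hE hE hP 0
    (by rw [comp_zero, hu, sub_self])
  exact homotopic_of_sub_eq_comp hE.exact_π.comp_eq_zero H (by rw [hα, sub_self])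
    H' (by rw [hu, sub_self]) hβ (g := id E) ((shift S).map_id M).symm h

lemma homotopyEquivalent_toNSeq (hFrob : IsFrobenius (Mod k C))
    {E E' : LongSeq r M ((shift S).obj M)} (hE : E.IsExact) (hE' : E'.IsExact)
    (hP : ∀ i, Projective (E.Y i)) (hP' : ∀ i, Projective (E'.Y i))
    (f : Map E E' (𝟙 M) (𝟙 _)) (g : Map E' E (𝟙 M) (𝟙 _)) :
    HomotopyEquivalent E.toNSeq E'.toNSeq := by
  -- `f (2g - gfg) - 1 = (1 - fg) (fg - 1)` and `(2g - gfg) f - 1 = (1 - gf) (gf - 1)`.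
  let g' := g.sub (((g.comp f).sub (id E')).comp g)
  refine ⟨f.toNSeq (by simp), g'.toNSeq (by simp),
    homotopic_id hFrob hE hP (x := f.comp g) (y := f.comp g') (by simp) (by simp) (by simp)
      fun i => ?_,
    homotopic_id hFrob hE' hP' (x := g.comp f) (y := g'.comp f) (by simp) (by simp) (by simp)
      fun i => ?_⟩ <;>
  · simp only [g', comp_φ, sub_φ, id_φ, Preadditive.comp_sub, Preadditive.sub_comp,
      Category.comp_id, Category.id_comp, Category.assoc]
    abel

lemma exists_toNSeq_eq (hFrob : IsFrobenius (Mod k C)) {E : LongSeq r M ((shift S).obj M)}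
    {E' : LongSeq r M' ((shift S).obj M')} (hE : E.IsExact) (hE' : E'.IsExact)
    (f : E.toNSeq ⟶ E'.toNSeq) :
    ∃ (u : M ⟶ M') (m : Map E E' u ((shift S).map u)), m.toNSeq rfl = f := by
  obtain ⟨u, hu⟩ := hE'.exact_ι.exists_lift hFrob hE'.inj (E.ι ≫ f.φ _) (by
    rw [Category.assoc, ← f.comm 0 (Nat.succ_pos _), reassoc_of% hE.exact_ι.comp_eq_zero,
      zero_comp])
  have := inj_iff_mono.1 (hE'.inj.shift_map (S := S))
  refine ⟨u, ⟨f.φ, hu.symm, f.comm, ?_⟩, rfl⟩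
  rw [← cancel_mono ((shift S).map E'.ι), Category.assoc, ← Functor.map_comp, hu,
    Functor.map_comp, ← Category.assoc, f.comm_last, Category.assoc]

lemma toStable_map_left_eq_of_homotopic (hFrob : IsFrobenius (Mod k C))
    {E : LongSeq r M ((shift S).obj M)} {E' : LongSeq r M' ((shift S).obj M')}
    (hE : E.ι ≫ E.d 0 (Nat.succ_pos _) = 0) (hE' : Inj E'.ι)
    (hP : Projective (E'.Y ⟨r + 1, Nat.lt_succ_self _⟩))
    {u u' : M ⟶ M'} {α α' : (shift S).obj M ⟶ (shift S).obj M'} {f : Map E E' u α}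
    {f' : Map E E' u' α'} {hα : α = (shift S).map u} {hα' : α' = (shift S).map u'}
    (h : Homotopic (f.toNSeq hα) (f'.toNSeq hα')) :
    (toStable (Mod k C)).map u = (toStable (Mod k C)).map u' := by
  obtain ⟨t, s, -, -, hs⟩ := h
  have := inj_iff_mono.1 (hE'.shift_map (S := S))
  refine toStable_map_eq_of_functor_map hFrob (shift S) <|
    CategoryTheory.Quotient.sound _ ⟨_, hP, (shift S).map E.ι ≫ s, E'.π, ?_⟩
  rw [← cancel_mono ((shift S).map E'.ι), ← Functor.map_sub, ← Functor.map_comp]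
  calc (shift S).map ((u - u') ≫ E'.ι)
      = (shift S).map E.ι ≫ (shift S).map (f.φ ⟨0, Nat.succ_pos _⟩ - f'.φ ⟨0, Nat.succ_pos _⟩) :=
        (congrArg (shift S).map (f.sub f').comm_ι.symm).trans (Functor.map_comp _ _ _)
    _ = (shift S).map E.ι ≫ ((shift S).map (E.d 0 (Nat.succ_pos _) ≫ t 0 (Nat.succ_pos _)) +
          s ≫ E'.π ≫ (shift S).map E'.ι) := congrArg ((shift S).map E.ι ≫ ·) hs
    _ = (((shift S).map E.ι ≫ s) ≫ E'.π) ≫ (shift S).map E'.ι := by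
        rw [Preadditive.comp_add, ← Functor.map_comp, reassoc_of% hE, zero_comp,
          Functor.map_zero, zero_add, Category.assoc, Category.assoc]

end Map

end LongSeq

end Modules

/-! ### `n`-`Σ`-complexes and standard `n`-angles -/

section Modules

variable {k : Type w} [Field k] {C : Type u} [Category.{v} C] [Preadditive C] [Linear k C]

lemma HomExact.yon_map {X Y Z : C} {f : X ⟶ Y} {g : Y ⟶ Z} (h : HomExact f g) :
    Exact ((yon k C).map f) ((yon k C).map g) :=
  fun W => h (unop W)

variable {S : C ≌ C} [S.functor.Additive] [S.functor.Linear k] {r : ℕ}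

lemma projective_toMod (hFrob : IsFrobenius (Mod k C)) (X : NSeq S.functor r) (i : Fin (r + 2)) :
    Projective ((toMod k X).X i) :=
  projective_yon hFrob (X.X i)

namespace NSeq.exact

variable {X : NSeq S.functor r}

lemma exact_d_last (hX : NSeq.exact X) :
    Exact ((toMod k X).d r (Nat.lt_succ_self _)) (toMod k X).last :=
  (inj_iff_mono.2 inferInstance : Inj ((yonShift S).hom.app _)).exact_comp_iff.2 hX.2.1.yon_map

lemma exact_last_shift_map_d (hX : NSeq.exact X) :
    Exact (toMod k X).last ((shift S).map ((toMod k X).d 0 (Nat.succ_pos _))) := by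
  refine Exact.of_comp_iso_hom (e := (yonShift (k := k) S).app _) ?_
  have hj : Inj ((yonShift (k := k) S).hom.app (X.X ⟨1, Nat.succ_lt_succ (Nat.succ_pos _)⟩)) :=
    inj_iff_mono.2 inferInstance
  have hs := (yonShift (k := k) S).hom.naturality (X.d 0 (Nat.succ_pos _))
  exact hs ▸ hj.exact_comp_iff.2 hX.2.2.yon_map

variable {M : Mod k C} {l : M ⟶ (toMod k X).X ⟨0, Nat.succ_pos _⟩}
  {π : (toMod k X).X ⟨r + 1, Nat.lt_succ_self _⟩ ⟶ (shift S).obj M}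

lemma kerSeq_isExact (hX : NSeq.exact X) (hl : Inj l)
    (hld : Exact l ((toMod k X).d 0 (Nat.succ_pos _)))
    (hπ : π ≫ (shift S).map l = (toMod k X).last) : (kerSeq X l π).IsExact where
  inj := hl
  exact_ι := hld
  exact_d i hi := (hX.1 i hi).yon_map
  exact_π := hl.shift_map.exact_comp_iff.1 (hπ ▸ hX.exact_d_last)
  surj := surj_of_exact_comp hl.shift_map hld.shift_map.comp_eq_zero
    (hπ ▸ hX.exact_last_shift_map_d)

end NSeq.exact

lemma kerSeq_toNSeq {X : NSeq S.functor r} {M : Mod k C}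
    {l : M ⟶ (toMod k X).X ⟨0, Nat.succ_pos _⟩}
    {π : (toMod k X).X ⟨r + 1, Nat.lt_succ_self _⟩ ⟶ (shift S).obj M}
    (hπ : π ≫ (shift S).map l = (toMod k X).last) : (kerSeq X l π).toNSeq = toMod k X :=
  congrArg (NSeq.mk _ _) hπ

lemma NSeq.exact.exists_kernel (hFrob : IsFrobenius (Mod k C)) {X : NSeq S.functor r}
    (hX : NSeq.exact X) :
    ∃ (M : Mod k C) (l : M ⟶ (toMod k X).X ⟨0, Nat.succ_pos _⟩)
      (π : (toMod k X).X ⟨r + 1, Nat.lt_succ_self _⟩ ⟶ (shift S).obj M),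
      Inj l ∧ Exact l ((toMod k X).d 0 (Nat.succ_pos _)) ∧
        π ≫ (shift S).map l = (toMod k X).last := by
  obtain ⟨M, l, hl, hld⟩ := exists_inj_exact hFrob ((toMod k X).d 0 (Nat.succ_pos _))
  obtain ⟨π, hπ⟩ := hld.shift_map.exists_lift hFrob hl.shift_map (toMod k X).last
    hX.exact_last_shift_map_d.comp_eq_zero
  exact ⟨M, l, π, hl, hld, hπ⟩

/-- The values of the sequence of functors at a morphism `q`, as a morphism of sequences. -/
def FunctorSeq.evalMap (T : FunctorSeq (k := k) S r) {M N : Mod k C} (q : M ⟶ N) :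
    LongSeq.Map (T.eval M) (T.eval N) q ((shift S).map q) where
  φ i := (T.X i).map q
  comm_ι := (T.ι.naturality q).symm
  comm_d i h := ((T.d i h).naturality q).symm
  comm_π := (T.π.naturality q).symm

variable {T : FunctorSeq (k := k) S r}

lemma Phi.htpyStandard (hFrob : IsFrobenius (Mod k C)) {c : Cosyzygies k C}
    {X : NComplex S.functor r} (hX : Phi c T X) : HtpyStandard T X := by
  obtain ⟨M, l, π, hl, hld, hπ, α, β, hα, hβ, h⟩ := hX
  obtain ⟨a⟩ := LongSeq.isComparison_iff.1 hα
  obtain ⟨b⟩ := LongSeq.isComparison_iff.1 hβ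
  have hE := X.property.kerSeq_isExact hl hld hπ
  have hP := projective_toMod hFrob X.obj
  have hR := c.resolution_isExact r M
  obtain ⟨f⟩ := LongSeq.exists_map_id_id hFrob hE (T.exact M) (T.projective · M) hR b a h
  obtain ⟨g⟩ := LongSeq.exists_map_id_id hFrob (T.exact M) hE hP hR a b h.symm
  have := LongSeq.Map.homotopyEquivalent_toNSeq hFrob hE (T.exact M) hP (T.projective · M) f g
  exact ⟨M, kerSeq_toNSeq hπ ▸ this⟩

lemma LongSeq.exists_retract_of_homotopyEquivalent (hFrob : IsFrobenius (Mod k C))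
    {M N : Mod k C} {E : LongSeq r M ((shift S).obj M)} {E' : LongSeq r N ((shift S).obj N)}
    (hE : E.IsExact) (hE' : E'.IsExact) (hP : ∀ i, Projective (E.Y i))
    (h : HomotopyEquivalent E.toNSeq E'.toNSeq) :
    ∃ (p : M ⟶ N) (q : N ⟶ M), Nonempty (Map E E' p ((shift S).map p)) ∧
      (toStable (Mod k C)).map (p ≫ q) = (toStable (Mod k C)).map (𝟙 M) := by
  obtain ⟨φ, ψ, h, -⟩ := h
  obtain ⟨p, f, rfl⟩ := Map.exists_toNSeq_eq hFrob hE hE' φ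
  obtain ⟨q, g, rfl⟩ := Map.exists_toNSeq_eq hFrob hE' hE ψ
  exact ⟨p, q, ⟨f⟩, Map.toStable_map_left_eq_of_homotopic hFrob hE.exact_ι.comp_eq_zero hE.inj
    (hP _) (f := f.comp g) (f' := Map.id E) (hα := ((shift S).map_comp p q).symm)
    (hα' := ((shift S).map_id M).symm) h⟩

lemma HtpyStandard.phi (hFrob : IsFrobenius (Mod k C)) (c : Cosyzygies k C)
    {X : NComplex S.functor r} (hX : HtpyStandard T X) : Phi c T X := by
  obtain ⟨N, hN⟩ := hX
  obtain ⟨M, l, π, hl, hld, hπ⟩ := X.property.exists_kernel hFrob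
  have hE := X.property.kerSeq_isExact hl hld hπ
  have hP := projective_toMod hFrob X.obj
  have hR := c.resolution_isExact r M
  have hPR (i : Fin (r + 2)) : Projective ((c.resolution r M).Y i) := c.projective _
  obtain ⟨α, ⟨a⟩⟩ := LongSeq.exists_map hFrob (T.exact M) hR hPR (𝟙 M)
  obtain ⟨β, ⟨b⟩⟩ := LongSeq.exists_map hFrob hE hR hPR (𝟙 M)
  refine ⟨M, l, π, hl, hld, hπ, α, β, LongSeq.isComparison_iff.2 ⟨a⟩,
    LongSeq.isComparison_iff.2 ⟨b⟩, ?_⟩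
  obtain ⟨p, q, ⟨f⟩, hpq⟩ := LongSeq.exists_retract_of_homotopyEquivalent hFrob hE (T.exact N) hP
    ((kerSeq_toNSeq hπ).symm ▸ hN)
  have hpq' : (toStable (Mod k C)).map ((p ≫ q) ≫ 𝟙 M) = (toStable (Mod k C)).map (𝟙 M) := by
    rw [Category.comp_id, hpq]
  have hα := ((T.evalMap (p ≫ q)).comp a).toStable_map_right_eq hFrob (T.exact M) hR hPR a hpq'
  have hβ := ((f.comp (T.evalMap q)).comp a).toStable_map_right_eq hFrob hE hR hPR b hpq'
  rw [← hβ, ← hα, Functor.map_comp (shift S)]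

end Modules

end NAngle

theorem proposition2p5_general
    {k : Type w} [Field k] {C : Type u} [Category.{v} C] [Preadditive C] [Linear k C]
    (S : C ≌ C) [S.functor.Additive] [S.functor.Linear k]
    (hFrob : NAngle.IsFrobenius (NAngle.Mod k C)) (r : ℕ)
    (T : NAngle.FunctorSeq (k := k) S r) (c : NAngle.Cosyzygies k C) :
    (∀ X : NAngle.NComplex S.functor r, NAngle.Phi c T X ↔ NAngle.HtpyStandard T X) ∧
    ∃ e : (NAngle.Phi c T).FullSubcategory ≌ (NAngle.HtpyStandard T).FullSubcategory,
      Nonempty (e.functor ⋙ (NAngle.HtpyStandard T).ι ≅ (NAngle.Phi c T).ι) := by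
  have phi_iff (X : NAngle.NComplex S.functor r) :
      NAngle.Phi c T X ↔ NAngle.HtpyStandard T X :=
    ⟨fun h => h.htpyStandard hFrob, fun h => h.phi hFrob c⟩
  refine ⟨phi_iff, ?_⟩
  rw [show NAngle.Phi c T = NAngle.HtpyStandard T from funext fun X => propext (phi_iff X)]
  exact ⟨CategoryTheory.Equivalence.refl, ⟨Functor.leftUnitor _⟩⟩

theorem proposition2p5
    {k : Type w} [Field k] [IsAlgClosed k]
    {C : Type u} [Category.{v} C] [Preadditive C] [Linear k C] [HasFiniteBiproducts C]
    [IsIdempotentComplete C]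
    (S : C ≌ C) [S.functor.Additive] [S.functor.Linear k]
    (hFrob : NAngle.IsFrobenius (NAngle.Mod k C))
    (r : ℕ) (hr : 1 ≤ r)
    (T : NAngle.FunctorSeq (k := k) S r)
    (c : NAngle.Cosyzygies k C) :
    (∀ X : NAngle.NComplex S.functor r, NAngle.Phi c T X ↔ NAngle.HtpyStandard T X) ∧
    ∃ e : (NAngle.Phi c T).FullSubcategory ≌ (NAngle.HtpyStandard T).FullSubcategory,
      Nonempty (e.functor ⋙ (NAngle.HtpyStandard T).ι ≅ (NAngle.Phi c T).ι) :=
  proposition2p5_general S hFrob r T c
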